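/- Let $\gamma\ge 1$, let $s=(1,1,\gamma)$, and for $x\ne y$ in $\mathbb R^3$ let $$g(x,y)=\frac{x-y}{\bigl((x_1-y_1)^2+(x_2-y_2)^2+\gamma^2(x_3-y_3)^2\bigr)^{3/2}}\in\mathbb R^3 .$$ For nonempty compact sets $S,T\subset\mathbb R^3$ (for instance finite sets of particle positions) put $$\operatorname{diam}_s(S)=\max_{x,y\in S}\|s\circ(x-y)\|_2,\qquad \operatorname{dist}_s(S,T)=\min_{x\in S,\,y\in T}\|s\circ(x-y)\|_2,$$ where $\circ$ is the componentwise product, and let $Q(S)=\prod_{k=1}^3[\min_{x\in S}x_k,\max_{x\in S}x_k]$ be the bounding box of $S$. Let $S_t,S_s$ be nonempty compact sets with bounding boxes $Q_t,Q_s$. Let $n\ge 0$, and on each side of $Q_t$ and of $Q_s$ let $n+1$ distinct interpolation nodes be given, with Lagrange basis polynomials $\ell_0,\dots,\ell_n$ such that $\sum_i|\ell_i|\le\Lambda$ on that side (the Lebesgue constant is at most $\Lambda$). Let $\xi_{t,\mu},\xi_{s,\nu}$ ($\mu,\nu\in\{0,\dots,n\}^3$) be the resulting tensor grid points, $\ell_{t,\mu},\ell_{s,\nu}$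 the products of the three univariate basis polynomials, and $$\tilde g(x,y)=\sum_{\mu}\sum_{\nu}\ell_{t,\mu}(x)\,g(\xi_{t,\mu},\xi_{s,\nu})\,\ell_{s,\nu}(y).$$ Write $\delta=\max(\operatorname{diam}_s(S_t),\operatorname{diam}_s(S_s))$ and $\|g-\tilde g\|_{\infty,Q_t\times Q_s}=\sup_{x\in Q_t,\,y\in Q_s}\max_k|g_k(x,y)-\tilde g_k(x,y)|$. (a) There is a constant $C>0$ depending only on $n$ and $\Lambda$ (not on $\gamma$, the sets or the nodes) such that, whenever $d=\operatorname{dist}_s(Q_t,Q_s)>0$, $$\|g-\tilde g\|_{\infty,Q_t\times Q_s}\le\frac{C}{d^2}\Bigl(\frac{\delta}{d}\Bigr)^{n+1}.$$ In particular, if $\delta/d<\eta$ for some $\eta>0$, the error is at most $C\,d^{-2}\,\eta^{n+1}$. (b) For every $\eta$ with $0<\eta<1/\sqrt6$ there is a constant $C>0$ depending only on $n$, $\Lambda$ and $\eta$ such that, whenever $d=\operatorname{dist}_s(S_t,S_s)>0$ and the admissibility condition $\delta/d<\eta$ holds, $$\|g-\tilde g\|_{\infty,Q_t\times Q_s}\le\frac{C}{d^2}\Bigl(\frac{\delta}{d}\Bigr)^{n+1}\le\frac{C}{d^2}\,\eta^{n+1}.$$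 -/

import Mathlib

noncomputable section

namespace RelativisticFMM

/-- The stretch vector `(1, 1, γ)`. -/
def stretch (γ : ℝ) : Fin 3 → ℝ := ![1, 1, γ]

/-- The stretched Euclidean distance `‖s ∘ (x - y)‖₂` of two points of `ℝ³`. -/
def stretchedNorm (s x y : Fin 3 → ℝ) : ℝ :=
  ‖WithLp.toLp 2 (fun k => s k * (x k - y k))‖

/-- The stretched diameter of a set: the supremum (a maximum when the set is compact and nonempty)
of the stretched distances between two of its points. -/
def stretchedDiam (s : Fin 3 → ℝ) (S : Set (Fin 3 → ℝ)) : ℝ :=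
  sSup {r | ∃ x ∈ S, ∃ y ∈ S, r = stretchedNorm s x y}

/-- The stretched distance of two sets: the infimum (a minimum when both are compact and nonempty)
of the stretched distances between a point of the first and a point of the second. -/
def stretchedDist (s : Fin 3 → ℝ) (S T : Set (Fin 3 → ℝ)) : ℝ :=
  sInf {r | ∃ x ∈ S, ∃ y ∈ T, r = stretchedNorm s x y}

/-- The axis-parallel bounding box `[a₁, b₁] × [a₂, b₂] × [a₃, b₃]` of a set, where `a k` and `b k`
are the smallest and the largest value of the `k`-th coordinate on the set. -/
def boundingBox (S : Set (Fin 3 → ℝ)) : Set (Fin 3 → ℝ) :=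
  Set.Icc (fun k => sInf ((fun x : Fin 3 → ℝ => x k) '' S))
    (fun k => sSup ((fun x : Fin 3 → ℝ => x k) '' S))

/-- The relativistic kernel
`g(x, y) = (x - y) / ((x₁ - y₁)² + (x₂ - y₂)² + γ² (x₃ - y₃)²) ^ (3/2)`, with values in `ℝ³`. -/
def kernel (γ : ℝ) (x y : Fin 3 → ℝ) : Fin 3 → ℝ := fun k =>
  (x k - y k) /
    ((x 0 - y 0) ^ 2 + (x 1 - y 1) ^ 2 + γ ^ 2 * (x 2 - y 2) ^ 2) ^ ((3 : ℝ) / 2)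

/-- The point `(ξ_{1, μ₁}, ξ_{2, μ₂}, ξ_{3, μ₃})` of the tensor grid with axis nodes `ξ`. -/
def gridPoint {n : ℕ} (ξ : Fin 3 → Fin (n + 1) → ℝ) (μ : Fin 3 → Fin (n + 1)) : Fin 3 → ℝ :=
  fun k => ξ k (μ k)

/-- The univariate Lagrange basis polynomial of degree `n` for the nodes `ξ 0, …, ξ n` that
belongs to the `i`-th node, evaluated at `t`. -/
def lagrange {n : ℕ} (ξ : Fin (n + 1) → ℝ) (i : Fin (n + 1)) (t : ℝ) : ℝ :=
  (Lagrange.basis Finset.univ ξ i).eval t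

/-- The tensor-product Lagrange basis polynomial
`ℓ_μ(x) = ℓ_{1, μ₁}(x₁) ℓ_{2, μ₂}(x₂) ℓ_{3, μ₃}(x₃)`. -/
def tensorLagrange {n : ℕ} (ξ : Fin 3 → Fin (n + 1) → ℝ) (μ : Fin 3 → Fin (n + 1))
    (x : Fin 3 → ℝ) : ℝ :=
  ∏ k, lagrange (ξ k) (μ k) (x k)

/-- The tensor-product interpolant of `G` in both variables:
`∑ μ, ∑ ν, ℓ_{t, μ}(x) G(ξ_{t, μ}, ξ_{s, ν}) ℓ_{s, ν}(y)`. -/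
def interpolant {n : ℕ} (ξt ξs : Fin 3 → Fin (n + 1) → ℝ)
    (G : (Fin 3 → ℝ) → (Fin 3 → ℝ) → (Fin 3 → ℝ)) (x y : Fin 3 → ℝ) : Fin 3 → ℝ :=
  ∑ μ : Fin 3 → Fin (n + 1), ∑ ν : Fin 3 → Fin (n + 1),
    (tensorLagrange ξt μ x * tensorLagrange ξs ν y) • G (gridPoint ξt μ) (gridPoint ξs ν)

/-- `ξ` gives the axis nodes of a tensor grid of degree `n` in `Q`: the `n + 1` nodes on each axis
are distinct and all grid points lie in `Q`. The Lebesgue constants (the suprema of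
`∑ i, |ℓ_i|` over the sides of the box `Q`) are at most `Λ`. -/
structure IsInterpolationGrid {n : ℕ} (Λ : ℝ) (Q : Set (Fin 3 → ℝ))
    (ξ : Fin 3 → Fin (n + 1) → ℝ) : Prop where
  injective : ∀ k, Function.Injective (ξ k)
  mem : ∀ μ : Fin 3 → Fin (n + 1), gridPoint ξ μ ∈ Q
  lebesgue_le : ∀ k, ∀ x ∈ Q, ∑ i, |lagrange (ξ k) i (x k)| ≤ Λ

end RelativisticFMM

end

open Polynomial

namespace RelativisticFMM

/-! Along one coordinate direction with the other coordinates frozen, the squared stretched distance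
is `τ² + B` with `τ = α t + β` and `|α|` the stretch factor. Each kernel component is then a
multiple of `τ ^ i / r ^ (i + q)`, where `r = √(τ² + B)`. Differentiating such a function costs a
factor `α / r`, so on an interval of stretched length at most `W` where `r ≥ ρ` it is within `C (W /
ρ) ^ m / ρ ^ q` of a polynomial of degree below `m` (`exists_polynomial_approx_radial`). Only the
product `|α| (b - a)` enters, and stretched sides of the box are at most `δ`: this is why `γ` drops
out.

Lagrange interpolation reproduces these polynomials, so each univariate error grows only by `1 + Λ`;
`abs_sub_tensor_le` combines three directions, and antisymmetry of the kernel gives the second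
variable. This proves (a) with any lower bound `D` for the distance of the boxes.

For (b), every point of a bounding box is within `√5 / 2 * δ` of its set
(`exists_stretchedNorm_sq_le`), so the boxes stay at distance at least `(1 - √6 η) d`. -/

/-! ### Polynomial approximation of homogeneous radial functions -/

/-- The homogeneous functions `τ ^ i / √(τ² + B) ^ (i + q)` of an affine argument `τ = α t + β`;
this family is closed under differentiation up to linear combinations. -/
noncomputable def radial (α β B : ℝ) (i q : ℕ) (t : ℝ) : ℝ :=
  (α * t + β) ^ i / √((α * t + β) ^ 2 + B) ^ (i + q)

/-- Each derivative raises the decay order `q` by one. For `i = 0` the truncated index `i - 1` is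
harmless, since its coefficient vanishes. -/
lemma hasDerivAt_radial (α β B : ℝ) (i q : ℕ) (t : ℝ) (h : 0 < (α * t + β) ^ 2 + B) :
    HasDerivAt (radial α β B i q)
      (α * (i * radial α β B (i - 1) (q + 1) t
        - (i + q : ℕ) * radial α β B (i + 1) (q + 1) t)) t := by
  have h1 : HasDerivAt (fun t : ℝ => α * t + β) α t := by
    simpa using ((hasDerivAt_id t).const_mul α).add_const β
  have h2 := ((h1.pow 2).add_const B).sqrt h.ne'
  have hr : 0 < √((α * t + β) ^ 2 + B) := Real.sqrt_pos.2 h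
  have h3 := (h1.pow i).div (h2.pow (i + q)) (pow_pos hr _).ne'
  refine h3.congr_deriv ?_
  simp only [radial, Pi.pow_apply]
  generalize √((α * t + β) ^ 2 + B) = r at *
  generalize α * t + β = τ at *
  rcases i with _ | i
  · rcases q with _ | q
    · simp
    · simp
      field_simp
      ring
  · simp only [Nat.add_sub_cancel, show i + 1 + q - 1 = i + q by omega]
    push_cast
    field_simp
    ring

lemma abs_radial_le (α β B : ℝ) (hB : 0 ≤ B) (i q : ℕ) (t ρ : ℝ) (hρ : 0 < ρ)
    (h : ρ ≤ √((α * t + β) ^ 2 + B)) : |radial α β B i q t| ≤ 1 / ρ ^ q := by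
  have hr : 0 < √((α * t + β) ^ 2 + B) := hρ.trans_le h
  have hτ : |α * t + β| ≤ √((α * t + β) ^ 2 + B) := Real.abs_le_sqrt (by linarith)
  rw [radial, abs_div, abs_pow, abs_of_pos (pow_pos hr _), pow_add, ← div_div, ← div_pow]
  have h1 : (|α * t + β| / √((α * t + β) ^ 2 + B)) ^ i ≤ 1 :=
    pow_le_one₀ (by positivity) ((div_le_one hr).2 hτ)
  gcongr

lemma exists_derivative_eq (p : ℝ[X]) (m : ℕ) (hp : p.degree < m) :
    ∃ P : ℝ[X], P.derivative = p ∧ P.degree < (m + 1 : ℕ) := by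
  rcases Nat.eq_zero_or_pos m with rfl | hm
  · have hp0 : p = 0 := by simpa using hp
    exact ⟨0, by simp [hp0], by simp⟩
  refine ⟨∑ i ∈ Finset.range m, monomial (i + 1) (p.coeff i / (i + 1)), ?_, ?_⟩
  · rw [derivative_sum]
    conv_rhs => rw [p.as_sum_range' m (by
      rcases eq_or_ne p 0 with rfl | h0
      · simpa using hm
      · exact (natDegree_lt_iff_degree_lt h0).2 hp)]
    refine Finset.sum_congr rfl fun i _ => ?_
    rw [derivative_monomial]
    push_cast
    congr 1
    field_simp
  · refine (degree_sum_le _ _).trans_lt ?_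
    rw [Finset.sup_lt_iff (WithBot.bot_lt_coe _)]
    intro i hi
    refine (degree_monomial_le _ _).trans_lt ?_
    rw [Finset.mem_range] at hi
    exact_mod_cast Nat.succ_lt_succ hi

/-- Polynomial approximation of `radial` on an interval, with the scaling of a Taylor remainder. -/
lemma exists_polynomial_approx_radial (m i q : ℕ) : ∃ C : ℝ, 0 ≤ C ∧
    ∀ α β B a b W ρ : ℝ, 0 ≤ B → 0 < ρ → a ≤ b → |α| * (b - a) ≤ W →
      (∀ t ∈ Set.Icc a b, ρ ≤ √((α * t + β) ^ 2 + B)) →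
      ∃ p : ℝ[X], p.degree < m ∧
        ∀ t ∈ Set.Icc a b, |radial α β B i q t - p.eval t| ≤ C * W ^ m / ρ ^ (q + m) := by
  induction m generalizing i q with
  | zero =>
    refine ⟨1, zero_le_one, fun α β B a b W ρ hB hρ hab hW hr => ⟨0, by simp, fun t ht => ?_⟩⟩
    simpa using abs_radial_le α β B hB i q t ρ hρ (hr t ht)
  | succ m ih =>
    -- Approximate the two terms of the derivative, then integrate the approximant; one integration
    -- supplies the extra factor `W`.
    obtain ⟨C₁, hC₁, H₁⟩ := ih (i - 1) (q + 1)
    obtain ⟨C₂, hC₂, H₂⟩ := ih (i + 1) (q + 1)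
    refine ⟨i * C₁ + (i + q : ℕ) * C₂, by positivity,
      fun α β B a b W ρ hB hρ hab hW hr => ?_⟩
    obtain ⟨p₁, hd₁, hp₁⟩ := H₁ α β B a b W ρ hB hρ hab hW hr
    obtain ⟨p₂, hd₂, hp₂⟩ := H₂ α β B a b W ρ hB hρ hab hW hr
    have hW0 : 0 ≤ W := (mul_nonneg (abs_nonneg α) (sub_nonneg.2 hab)).trans hW
    have hd : ((α * i) • p₁ - (α * (i + q : ℕ)) • p₂).degree < (m : WithBot ℕ) := by
      refine (degree_sub_le _ _).trans_lt (max_lt ?_ ?_)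
      · exact (degree_smul_le _ _).trans_lt hd₁
      · exact (degree_smul_le _ _).trans_lt hd₂
    obtain ⟨P, hP, hPd⟩ := exists_derivative_eq _ m hd
    -- This constant of integration makes the error vanish at `a`, so the mean value inequality
    -- bounds it on the whole interval.
    set c : ℝ := radial α β B i q a - P.eval a with hc
    refine ⟨P + C c, ?_, fun t ht => ?_⟩
    · refine (degree_add_le _ _).trans_lt (max_lt hPd (degree_C_le.trans_lt ?_))
      exact_mod_cast Nat.succ_pos m
    set K : ℝ := |α| * ((i * C₁ + (i + q : ℕ) * C₂) * W ^ m / ρ ^ (q + 1 + m)) with hK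
    have hderiv : ∀ u ∈ Set.Icc a b, HasDerivWithinAt
        (fun u => radial α β B i q u - P.eval u)
        (α * (i * radial α β B (i - 1) (q + 1) u
          - (i + q : ℕ) * radial α β B (i + 1) (q + 1) u) - P.derivative.eval u)
        (Set.Icc a b) u := fun u hu =>
      ((hasDerivAt_radial α β B i q u (Real.sqrt_pos.1 (hρ.trans_le (hr u hu)))).sub
        (P.hasDerivAt u)).hasDerivWithinAt
    have hbound : ∀ u ∈ Set.Icc a b, ‖α * (i * radial α β B (i - 1) (q + 1) u
          - (i + q : ℕ) * radial α β B (i + 1) (q + 1) u) - P.derivative.eval u‖ ≤ K := by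
      intro u hu
      have e : α * (i * radial α β B (i - 1) (q + 1) u
          - (i + q : ℕ) * radial α β B (i + 1) (q + 1) u) - P.derivative.eval u
          = α * (i * (radial α β B (i - 1) (q + 1) u - p₁.eval u)
            - (i + q : ℕ) * (radial α β B (i + 1) (q + 1) u - p₂.eval u)) := by
        rw [hP]
        simp only [eval_sub, eval_smul, smul_eq_mul]
        ring
      rw [e, Real.norm_eq_abs, abs_mul, hK]
      gcongr
      refine (abs_sub _ _).trans ?_
      rw [abs_mul, abs_mul, Nat.abs_cast, Nat.abs_cast]
      calc _ ≤ (i : ℝ) * (C₁ * W ^ m / ρ ^ (q + 1 + m))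
            + (i + q : ℕ) * (C₂ * W ^ m / ρ ^ (q + 1 + m)) := by
            gcongr
            · exact hp₁ u hu
            · exact hp₂ u hu
        _ = _ := by ring
    have key := (convex_Icc a b).norm_image_sub_le_of_norm_hasDerivWithin_le hderiv hbound
      (Set.left_mem_Icc.2 hab) ht
    have hK0 : 0 ≤ (i * C₁ + (i + q : ℕ) * C₂) * W ^ m / ρ ^ (q + 1 + m) := by positivity
    have e2 : radial α β B i q t - (P + C c).eval t
        = radial α β B i q t - P.eval t - (radial α β B i q a - P.eval a) := by
      simp only [eval_add, eval_C, hc]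
      ring
    rw [e2]
    refine key.trans ?_
    rw [Real.norm_eq_abs, abs_of_nonneg (sub_nonneg.2 ht.1), hK]
    calc _ = ((i * C₁ + (i + q : ℕ) * C₂) * W ^ m / ρ ^ (q + 1 + m)) * (|α| * (t - a)) := by ring
      _ ≤ ((i * C₁ + (i + q : ℕ) * C₂) * W ^ m / ρ ^ (q + 1 + m)) * W := by
          gcongr
          refine le_trans ?_ hW
          gcongr
          exact ht.2
      _ = _ := by
          rw [show q + (m + 1) = q + 1 + m by ring]
          ring

/-! ### Lagrange interpolation in one and several variables -/

lemma sum_lagrange_eval {n : ℕ} {ξ : Fin (n + 1) → ℝ} (hξ : Function.Injective ξ)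
    {p : ℝ[X]} (hp : p.degree < (n + 1 : ℕ)) (t : ℝ) :
    ∑ i, lagrange ξ i t * p.eval (ξ i) = p.eval t := by
  have h := Lagrange.eq_interpolate (s := Finset.univ) (v := ξ) hξ.injOn (f := p)
    (by simpa using hp)
  conv_rhs => rw [h]
  simp [Lagrange.interpolate_apply, eval_finsetSum, lagrange, mul_comm]

/-- Interpolation fixes `p`, so the error is that of `f - p`, bounded by `E` at `t` and by `Λ * E`
after interpolation. -/
lemma abs_sub_lagrange_le {n : ℕ} {ξ : Fin (n + 1) → ℝ} (hξ : Function.Injective ξ)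
    {p : ℝ[X]} (hp : p.degree < (n + 1 : ℕ)) {f : ℝ → ℝ} {A : Set ℝ} {E Λ t : ℝ}
    (hf : ∀ u ∈ A, |f u - p.eval u| ≤ E) (hA : ∀ i, ξ i ∈ A) (ht : t ∈ A)
    (hΛ : ∑ i, |lagrange ξ i t| ≤ Λ) :
    |f t - ∑ i, lagrange ξ i t * f (ξ i)| ≤ (1 + Λ) * E := by
  have hE : 0 ≤ E := (abs_nonneg _).trans (hf t ht)
  have e : f t - ∑ i, lagrange ξ i t * f (ξ i)
      = (f t - p.eval t) - ∑ i, lagrange ξ i t * (f (ξ i) - p.eval (ξ i)) := by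
    simp only [mul_sub, Finset.sum_sub_distrib, sum_lagrange_eval hξ hp]
    ring
  rw [e]
  refine (abs_sub _ _).trans ?_
  have h2 : |∑ i, lagrange ξ i t * (f (ξ i) - p.eval (ξ i))| ≤ Λ * E := by
    refine (Finset.abs_sum_le_sum_abs _ _).trans ?_
    calc _ ≤ ∑ i, |lagrange ξ i t| * E := by
          gcongr with i
          rw [abs_mul]
          gcongr
          exact hf _ (hA i)
      _ = (∑ i, |lagrange ξ i t|) * E := by rw [Finset.sum_mul]
      _ ≤ _ := by gcongr
  linarith [hf t ht]

lemma one_le_sum_abs_lagrange {n : ℕ} {ξ : Fin (n + 1) → ℝ} (hξ : Function.Injective ξ) (t : ℝ) :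
    1 ≤ ∑ i, |lagrange ξ i t| := by
  have h := sum_lagrange_eval hξ (p := 1) (degree_one_le.trans_lt (by exact_mod_cast n.succ_pos)) t
  simp only [eval_one, mul_one] at h
  calc (1 : ℝ) = |∑ i, lagrange ξ i t| := by rw [h, abs_one]
    _ ≤ _ := Finset.abs_sum_le_sum_abs _ _

/-- The error of a tensor-product sampling operator is controlled by the errors of the
coordinatewise operators. -/
lemma abs_sub_tensor_le {κ : Type*} [Fintype κ] {Λ E : ℝ} (hΛ : 1 ≤ Λ) (hE : 0 ≤ E) (d : ℕ)
    (A : Fin d → Set ℝ) (ξ : Fin d → κ → ℝ) (w : Fin d → κ → ℝ → ℝ)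
    (hξ : ∀ k i, ξ k i ∈ A k) (hw : ∀ k, ∀ t ∈ A k, ∑ i, |w k i t| ≤ Λ)
    (f : (Fin d → ℝ) → ℝ)
    (hf : ∀ k z, (∀ j, z j ∈ A j) →
      |f z - ∑ i, w k i (z k) * f (Function.update z k (ξ k i))| ≤ E)
    (z : Fin d → ℝ) (hz : ∀ j, z j ∈ A j) :
    |f z - ∑ μ : Fin d → κ, (∏ k, w k (μ k) (z k)) * f (fun k => ξ k (μ k))|
      ≤ d * Λ ^ d * E := by
  induction d with
  | zero =>
    have : z = fun k => ξ k ((default : Fin 0 → κ) k) := Subsingleton.elim _ _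
    simp [← this]
  | succ d ih =>
    have hsum : ∑ μ : Fin (d + 1) → κ, (∏ k, w k (μ k) (z k)) * f (fun k => ξ k (μ k))
        = ∑ i, w 0 i (z 0) * ∑ μ : Fin d → κ, (∏ k : Fin d, w k.succ (μ k) (z k.succ)) *
            f (Fin.cons (ξ 0 i) (fun k : Fin d => ξ k.succ (μ k))) := by
      rw [← (Fin.consEquiv fun _ : Fin (d + 1) => κ).sum_comp, Fintype.sum_prod_type]
      refine Finset.sum_congr rfl fun i _ => ?_
      rw [Finset.mul_sum]
      refine Finset.sum_congr rfl fun μ _ => ?_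
      rw [Fin.prod_univ_succ, ← mul_assoc]
      simp only [Fin.consEquiv_apply, Fin.cons_zero, Fin.cons_succ]
      congr 2
      funext k
      refine Fin.cases ?_ (fun k => ?_) k <;> simp
    have hfirst := hf 0 z hz
    have hupd : ∀ i, Function.update z 0 (ξ 0 i) = Fin.cons (ξ 0 i) (Fin.tail z) := fun i => by
      conv_lhs => rw [← Fin.cons_self_tail z]
      rw [Fin.update_cons_zero]
    simp only [hupd] at hfirst
    have hrec : ∀ i, |f (Fin.cons (ξ 0 i) (Fin.tail z))
        - ∑ μ : Fin d → κ, (∏ k : Fin d, w k.succ (μ k) (z k.succ)) *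
            f (Fin.cons (ξ 0 i) (fun k : Fin d => ξ k.succ (μ k)))| ≤ d * Λ ^ d * E := by
      intro i
      refine ih (fun k => A k.succ) (fun k => ξ k.succ) (fun k => w k.succ)
        (fun k => hξ k.succ) (fun k => hw k.succ) (fun u => f (Fin.cons (ξ 0 i) u)) ?_
        (Fin.tail z) (fun j => hz j.succ)
      intro k u hu
      have := hf k.succ (Fin.cons (ξ 0 i) u : Fin (d + 1) → ℝ) (fun j => by
        refine Fin.cases ?_ (fun j => ?_) j
        · simpa using hξ 0 i
        · simpa using hu j)
      simpa only [Fin.cons_succ, ← Fin.cons_update] using this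
    rw [hsum]
    -- Telescoping: first the error of sampling coordinate 0, then the weighted errors of sampling
    -- the remaining coordinates.
    have hsplit : ∀ (a b : ℝ) (c G : κ → ℝ), a - ∑ i, c i * G i
        = (a - ∑ i, c i * f (Fin.cons (ξ 0 i) (Fin.tail z)))
          + ∑ i, c i * (f (Fin.cons (ξ 0 i) (Fin.tail z)) - G i) := by
      intro a b c G
      simp only [mul_sub, Finset.sum_sub_distrib]
      ring
    rw [hsplit _ 0]
    refine (abs_add_le _ _).trans ?_
    have h2 : |∑ i, w 0 i (z 0) * (f (Fin.cons (ξ 0 i) (Fin.tail z))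
        - ∑ μ : Fin d → κ, (∏ k : Fin d, w k.succ (μ k) (z k.succ)) *
            f (Fin.cons (ξ 0 i) (fun k : Fin d => ξ k.succ (μ k))))| ≤ Λ * (d * Λ ^ d * E) := by
      refine (Finset.abs_sum_le_sum_abs _ _).trans ?_
      calc _ ≤ ∑ i, |w 0 i (z 0)| * (d * Λ ^ d * E) := by
            gcongr with i
            rw [abs_mul]
            gcongr
            exact hrec i
        _ = (∑ i, |w 0 i (z 0)|) * (d * Λ ^ d * E) := by rw [Finset.sum_mul]
        _ ≤ _ := by
            have : 0 ≤ (d : ℝ) * Λ ^ d * E := by positivity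
            gcongr
            exact hw 0 _ (hz 0)
    have h3 : E ≤ Λ ^ (d + 1) * E := le_mul_of_one_le_left hE (one_le_pow₀ hΛ)
    push_cast
    calc _ ≤ E + Λ * (d * Λ ^ d * E) := add_le_add hfirst h2
      _ ≤ Λ ^ (d + 1) * E + Λ * (d * Λ ^ d * E) := by linarith
      _ = _ := by ring

lemma sum_abs_tensorLagrange_le {n : ℕ} {Λ : ℝ} (ξ : Fin 3 → Fin (n + 1) → ℝ) (x : Fin 3 → ℝ)
    (h : ∀ k, ∑ i, |lagrange (ξ k) i (x k)| ≤ Λ) :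
    ∑ μ, |tensorLagrange ξ μ x| ≤ Λ ^ 3 := by
  have e : ∑ μ, |tensorLagrange ξ μ x| = ∏ k, ∑ i, |lagrange (ξ k) i (x k)| := by
    rw [Finset.prod_univ_sum, Fintype.piFinset_univ]
    simp [tensorLagrange, Finset.abs_prod]
  rw [e]
  calc _ ≤ ∏ _k : Fin 3, Λ := Finset.prod_le_prod
        (fun k _ => Finset.sum_nonneg fun i _ => abs_nonneg _) (fun k _ => h k)
    _ = _ := by simp

/-! ### Stretched norm and bounding boxes -/

lemma stretchedNorm_sq (s x y : Fin 3 → ℝ) :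
    stretchedNorm s x y ^ 2 = ∑ k, (s k * (x k - y k)) ^ 2 := by
  rw [stretchedNorm, EuclideanSpace.norm_sq_eq]
  simp only [Real.norm_eq_abs, sq_abs]

lemma stretchedNorm_nonneg (s x y : Fin 3 → ℝ) : 0 ≤ stretchedNorm s x y := norm_nonneg _

lemma stretchedNorm_eq_sqrt (s x y : Fin 3 → ℝ) :
    stretchedNorm s x y = √(∑ k, (s k * (x k - y k)) ^ 2) := by
  rw [← stretchedNorm_sq, Real.sqrt_sq (stretchedNorm_nonneg s x y)]

lemma stretchedNorm_comm (s x y : Fin 3 → ℝ) : stretchedNorm s x y = stretchedNorm s y x := by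
  rw [stretchedNorm_eq_sqrt, stretchedNorm_eq_sqrt]
  congr 1
  exact Finset.sum_congr rfl fun k _ => by ring

lemma stretchedNorm_triangle (s x y z : Fin 3 → ℝ) :
    stretchedNorm s x z ≤ stretchedNorm s x y + stretchedNorm s y z := by
  unfold stretchedNorm
  refine le_of_eq_of_le ?_ (norm_add_le _ _)
  congr 1
  ext k
  simp
  ring

lemma abs_mul_le_stretchedNorm (s x y : Fin 3 → ℝ) (k : Fin 3) :
    |s k * (x k - y k)| ≤ stretchedNorm s x y := by
  simpa [stretchedNorm] using PiLp.norm_apply_le (WithLp.toLp 2 fun k => s k * (x k - y k)) k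

lemma continuous_stretchedNorm (s : Fin 3 → ℝ) :
    Continuous fun z : (Fin 3 → ℝ) × (Fin 3 → ℝ) => stretchedNorm s z.1 z.2 := by
  simp only [stretchedNorm_eq_sqrt]
  fun_prop

lemma stretchedNorm_combo_le {s a b y : Fin 3 → ℝ} {l δ : ℝ} (hl0 : 0 ≤ l) (hl1 : l ≤ 1)
    (ha : stretchedNorm s a y ≤ δ) (hb : stretchedNorm s b y ≤ δ) :
    stretchedNorm s (fun j => (1 - l) * a j + l * b j) y ≤ δ := by
  have e : stretchedNorm s (fun j => (1 - l) * a j + l * b j) y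
      ≤ (1 - l) * stretchedNorm s a y + l * stretchedNorm s b y := by
    have h1 : (1 - l) * stretchedNorm s a y
        = ‖(1 - l) • WithLp.toLp 2 (fun k => s k * (a k - y k))‖ := by
      rw [norm_smul, Real.norm_of_nonneg (sub_nonneg.2 hl1), stretchedNorm]
    have h2 : l * stretchedNorm s b y = ‖l • WithLp.toLp 2 (fun k => s k * (b k - y k))‖ := by
      rw [norm_smul, Real.norm_of_nonneg hl0, stretchedNorm]
    rw [h1, h2]
    refine le_of_eq_of_le ?_ (norm_add_le _ _)
    rw [stretchedNorm]
    congr 1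
    ext k
    simp
    ring
  nlinarith

/-- A point of the bounding box of a set of stretched diameter at most `δ` is within `√(5/4) δ` of
the set. The points `p k` and `q k` realise the faces of the box. -/
lemma exists_stretchedNorm_sq_le {s : Fin 3 → ℝ} {S : Set (Fin 3 → ℝ)} {δ : ℝ}
    (hS : ∀ x ∈ S, ∀ y ∈ S, stretchedNorm s x y ≤ δ) {p q : Fin 3 → Fin 3 → ℝ}
    (hp : ∀ k, p k ∈ S) (hq : ∀ k, q k ∈ S) {x : Fin 3 → ℝ}
    (hpx : ∀ k, p k k ≤ x k) (hxq : ∀ k, x k ≤ q k k) :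
    ∃ z ∈ S, stretchedNorm s x z ^ 2 ≤ 5 / 4 * δ ^ 2 := by
  have hl : ∀ k, ∃ l : ℝ, 0 ≤ l ∧ l ≤ 1 ∧ (1 - l) * p k k + l * q k k = x k := by
    intro k
    have hx : x k ∈ segment ℝ (p k k) (q k k) := by
      rw [segment_eq_Icc ((hpx k).trans (hxq k))]
      exact ⟨hpx k, hxq k⟩
    obtain ⟨u, l, hu, hl, hul, h⟩ := hx
    refine ⟨l, hl, by linarith, ?_⟩
    rw [← h, ← hul]
    simp
  choose l hl0 hl1 hlx using hl
  -- `m k` is the point of the segment from `p k` to `q k` whose `k`-th coordinate is that of `x`.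
  set m : Fin 3 → Fin 3 → ℝ := fun k j => (1 - l k) * p k j + l k * q k j with hm
  have hmS : ∀ k, ∀ y ∈ S, stretchedNorm s (m k) y ≤ δ := fun k y hy =>
    stretchedNorm_combo_le (hl0 k) (hl1 k) (hS _ (hp k) _ hy) (hS _ (hq k) _ hy)
  have hmm : ∀ k j, stretchedNorm s (m k) (m j) ^ 2 ≤ δ ^ 2 := fun k j => by
    refine pow_le_pow_left₀ (stretchedNorm_nonneg _ _ _) ?_ 2
    rw [stretchedNorm_comm]
    refine stretchedNorm_combo_le (hl0 j) (hl1 j) ?_ ?_ <;> rw [stretchedNorm_comm]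
    exacts [hmS k _ (hp j), hmS k _ (hq j)]
  have hmx : ∀ k, m k k = x k := hlx
  -- Since `m k` agrees with `x` in coordinate `k`, the three squared distances from `x` sum to at
  -- most the three mutual squared distances of the `m k`, hence to at most `3 δ²`.
  obtain ⟨k, hk⟩ : ∃ k, stretchedNorm s x (m k) ^ 2 ≤ δ ^ 2 := by
    by_contra! hcon
    have a0 := hcon 0
    have a1 := hcon 1
    have a2 := hcon 2
    have b0 := hmm 0 1
    have b1 := hmm 1 2
    have b2 := hmm 2 0
    simp only [stretchedNorm_sq, Fin.sum_univ_three, hmx] at a0 a1 a2 b0 b1 b2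
    nlinarith [sq_nonneg (s 2 * (m 0 2 - m 1 2)), sq_nonneg (s 0 * (m 1 0 - m 2 0)),
      sq_nonneg (s 1 * (m 2 1 - m 0 1))]
  have hpq : stretchedNorm s (p k) (q k) ^ 2 ≤ δ ^ 2 :=
    pow_le_pow_left₀ (stretchedNorm_nonneg _ _ _) (hS _ (hp k) _ (hq k)) 2
  -- Stewart's identity: a weighted mean of the squared distances to the endpoints is at most `δ² +
  -- δ² / 4`, so one endpoint is close enough.
  have hid : (1 - l k) * stretchedNorm s x (p k) ^ 2 + l k * stretchedNorm s x (q k) ^ 2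
      = stretchedNorm s x (m k) ^ 2
        + l k * (1 - l k) * stretchedNorm s (p k) (q k) ^ 2 := by
    simp only [stretchedNorm_sq, Fin.sum_univ_three, hm]
    ring
  have hquarter : l k * (1 - l k) ≤ 1 / 4 := by nlinarith [sq_nonneg (l k - 1 / 2)]
  have hprod : l k * (1 - l k) * stretchedNorm s (p k) (q k) ^ 2 ≤ 1 / 4 * δ ^ 2 :=
    mul_le_mul hquarter hpq (sq_nonneg _) (by norm_num)
  by_contra! hcon
  have c1 := hcon _ (hp k)
  have c2 := hcon _ (hq k)
  nlinarith [hl0 k, hl1 k, mul_nonneg (hl0 k) (sub_nonneg.2 c2.le),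
    mul_nonneg (sub_nonneg.2 (hl1 k)) (sub_nonneg.2 c1.le)]

lemma stretchedNorm_le_stretchedDiam {S : Set (Fin 3 → ℝ)} (hS : IsCompact S) (s : Fin 3 → ℝ)
    {x y : Fin 3 → ℝ} (hx : x ∈ S) (hy : y ∈ S) : stretchedNorm s x y ≤ stretchedDiam s S := by
  refine le_csSup ?_ ⟨x, hx, y, hy, rfl⟩
  refine ((hS.prod hS).image (continuous_stretchedNorm s)).bddAbove.mono ?_
  rintro r ⟨x, hx, y, hy, rfl⟩
  exact ⟨(x, y), ⟨hx, hy⟩, rfl⟩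

lemma stretchedDist_le_stretchedNorm (s : Fin 3 → ℝ) {S T : Set (Fin 3 → ℝ)}
    {x y : Fin 3 → ℝ} (hx : x ∈ S) (hy : y ∈ T) : stretchedDist s S T ≤ stretchedNorm s x y := by
  refine csInf_le ⟨0, ?_⟩ ⟨x, hx, y, hy, rfl⟩
  rintro r ⟨x, -, y, -, rfl⟩
  exact stretchedNorm_nonneg _ _ _

lemma exists_coord_eq_sInf {S : Set (Fin 3 → ℝ)} (hS : IsCompact S) (hne : S.Nonempty)
    (k : Fin 3) : ∃ p ∈ S, p k = sInf ((fun x : Fin 3 → ℝ => x k) '' S) := by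
  obtain ⟨p, hp, h⟩ := hS.exists_sInf_image_eq hne (continuous_apply k).continuousOn
  exact ⟨p, hp, h.symm⟩

lemma exists_coord_eq_sSup {S : Set (Fin 3 → ℝ)} (hS : IsCompact S) (hne : S.Nonempty)
    (k : Fin 3) : ∃ p ∈ S, p k = sSup ((fun x : Fin 3 → ℝ => x k) '' S) := by
  obtain ⟨p, hp, h⟩ := hS.exists_sSup_image_eq hne (continuous_apply k).continuousOn
  exact ⟨p, hp, h.symm⟩

lemma exists_near_of_mem_boundingBox {s : Fin 3 → ℝ} {S : Set (Fin 3 → ℝ)} (hS : IsCompact S)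
    (hne : S.Nonempty) {δ : ℝ} (hδ : stretchedDiam s S ≤ δ) {x : Fin 3 → ℝ}
    (hx : x ∈ boundingBox S) : ∃ z ∈ S, stretchedNorm s x z ^ 2 ≤ 5 / 4 * δ ^ 2 := by
  choose p hp hp' using exists_coord_eq_sInf hS hne
  choose q hq hq' using exists_coord_eq_sSup hS hne
  refine exists_stretchedNorm_sq_le
    (fun x hx y hy => (stretchedNorm_le_stretchedDiam hS s hx hy).trans hδ) hp hq
    (fun k => ?_) fun k => ?_
  · rw [hp']; exact hx.1 k
  · rw [hq']; exact hx.2 k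

lemma side_le {s : Fin 3 → ℝ} {S : Set (Fin 3 → ℝ)} (hS : IsCompact S)
    (hne : S.Nonempty) {δ : ℝ} (hδ : stretchedDiam s S ≤ δ) (k : Fin 3) :
    |s k| * (sSup ((fun x : Fin 3 → ℝ => x k) '' S) - sInf ((fun x : Fin 3 → ℝ => x k) '' S))
      ≤ δ := by
  obtain ⟨p, hp, hp'⟩ := exists_coord_eq_sInf hS hne k
  obtain ⟨q, hq, hq'⟩ := exists_coord_eq_sSup hS hne k
  rw [← hp', ← hq']
  refine le_trans ?_ ((stretchedNorm_le_stretchedDiam hS s hq hp).trans hδ)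
  refine le_trans ?_ (abs_mul_le_stretchedNorm s q p k)
  rw [abs_mul]
  gcongr
  exact le_abs_self _

lemma stretchedDiam_nonneg (s : Fin 3 → ℝ) (S : Set (Fin 3 → ℝ)) : 0 ≤ stretchedDiam s S := by
  refine Real.sSup_nonneg ?_
  rintro r ⟨x, -, y, -, rfl⟩
  exact stretchedNorm_nonneg _ _ _

/-- Under the admissibility condition the bounding boxes are separated. -/
lemma le_stretchedNorm_of_admissible {s : Fin 3 → ℝ} {S T : Set (Fin 3 → ℝ)} (hS : IsCompact S)
    (hSne : S.Nonempty) (hT : IsCompact T) (hTne : T.Nonempty) {δ η : ℝ}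
    (hδS : stretchedDiam s S ≤ δ) (hδT : stretchedDiam s T ≤ δ)
    (hδ : δ ≤ η * stretchedDist s S T) {x y : Fin 3 → ℝ} (hx : x ∈ boundingBox S)
    (hy : y ∈ boundingBox T) : (1 - √6 * η) * stretchedDist s S T ≤ stretchedNorm s x y := by
  obtain ⟨p, hp, hxp⟩ := exists_near_of_mem_boundingBox hS hSne hδS hx
  obtain ⟨q, hq, hyq⟩ := exists_near_of_mem_boundingBox hT hTne hδT hy
  have hδ0 : 0 ≤ δ := (stretchedDiam_nonneg s S).trans hδS
  have hs : √6 ^ 2 = 6 := Real.sq_sqrt (by norm_num)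
  have hs0 : 0 ≤ √6 := Real.sqrt_nonneg 6
  -- `√5 / 2` is relaxed to `√6 / 2`; the two boxes together lose at most `√6 * δ`.
  have hbound : ∀ r : ℝ, r ^ 2 ≤ 5 / 4 * δ ^ 2 → r ≤ √6 / 2 * δ := fun r hr => by
    refine le_of_sq_le_sq ?_ (by positivity)
    nlinarith [sq_nonneg δ]
  have h1 := hbound _ hxp
  have h2 := hbound _ hyq
  have h3 := stretchedDist_le_stretchedNorm s hp hq
  have h4 := stretchedNorm_triangle s p x q
  have h5 := stretchedNorm_triangle s x y q
  rw [stretchedNorm_comm s p x] at h4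
  nlinarith [mul_le_mul_of_nonneg_left hδ hs0]

/-! ### Interpolation error of the kernel -/

lemma kernel_eq (γ : ℝ) (x y : Fin 3 → ℝ) (k : Fin 3) :
    kernel γ x y k = (x k - y k) / stretchedNorm (stretch γ) x y ^ 3 := by
  have h : (x 0 - y 0) ^ 2 + (x 1 - y 1) ^ 2 + γ ^ 2 * (x 2 - y 2) ^ 2
      = stretchedNorm (stretch γ) x y ^ 2 := by
    simp only [stretchedNorm_sq, Fin.sum_univ_three, stretch, Matrix.cons_val]
    ring
  rw [kernel, h, ← Real.rpow_natCast _ 2, ← Real.rpow_mul (stretchedNorm_nonneg _ _ _),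
    ← Real.rpow_natCast _ 3]
  norm_num

lemma kernel_swap (γ : ℝ) (x y : Fin 3 → ℝ) (k : Fin 3) : kernel γ x y k = -kernel γ y x k := by
  rw [kernel_eq, kernel_eq, stretchedNorm_comm]
  ring

lemma one_le_stretch {γ : ℝ} (hγ : 1 ≤ γ) (k : Fin 3) : 1 ≤ stretch γ k := by
  fin_cases k <;> simp [stretch, hγ]

lemma stretchedNorm_update (s x y : Fin 3 → ℝ) (k : Fin 3) (t : ℝ) :
    stretchedNorm s (Function.update x k t) y
      = √((s k * t + -(s k * y k)) ^ 2
        + ∑ j ∈ Finset.univ.erase k, (s j * (x j - y j)) ^ 2) := by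
  rw [stretchedNorm_eq_sqrt, ← Finset.add_sum_erase _ _ (Finset.mem_univ k)]
  congr 2
  · rw [Function.update_self]
    ring
  · refine Finset.sum_congr rfl fun j hj => ?_
    rw [Function.update_of_ne (Finset.ne_of_mem_erase hj)]

/-- Polynomial approximation of the components of the kernel along a coordinate direction. -/
lemma exists_polynomial_approx_kernel (m : ℕ) : ∃ C : ℝ, 0 ≤ C ∧
    ∀ γ : ℝ, 1 ≤ γ → ∀ (a b W D : ℝ) (k c : Fin 3) (x y : Fin 3 → ℝ), 0 < D → a ≤ b →
      |stretch γ k| * (b - a) ≤ W →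
      (∀ t ∈ Set.Icc a b, D ≤ stretchedNorm (stretch γ) (Function.update x k t) y) →
      ∃ p : ℝ[X], p.degree < m ∧ ∀ t ∈ Set.Icc a b,
        |kernel γ (Function.update x k t) y c - p.eval t| ≤ C * W ^ m / D ^ (2 + m) := by
  obtain ⟨C₁, hC₁, H₁⟩ := exists_polynomial_approx_radial m 1 2
  obtain ⟨C₂, hC₂, H₂⟩ := exists_polynomial_approx_radial m 0 3
  refine ⟨C₁ + C₂, by positivity, fun γ hγ a b W D k c x y hD hab hW hr => ?_⟩
  set B := ∑ j ∈ Finset.univ.erase k, (stretch γ j * (x j - y j)) ^ 2 with hB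
  have hB0 : 0 ≤ B := Finset.sum_nonneg fun _ _ => sq_nonneg _
  have hs := one_le_stretch hγ k
  have hs0 : 0 < stretch γ k := by linarith
  have hW0 : 0 ≤ W := (mul_nonneg (abs_nonneg _) (sub_nonneg.2 hab)).trans hW
  have hr' := hr
  simp only [stretchedNorm_update, ← hB] at hr'
  rcases eq_or_ne c k with rfl | hck
  · obtain ⟨p, hp, hpe⟩ := H₁ _ (-(stretch γ c * y c)) B a b W D hB0 hD hab hW hr'
    refine ⟨(stretch γ c)⁻¹ • p, (degree_smul_le _ _).trans_lt hp, fun t ht => ?_⟩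
    have e : kernel γ (Function.update x c t) y c
        = (stretch γ c)⁻¹ * radial (stretch γ c) (-(stretch γ c * y c)) B 1 2 t := by
      rw [kernel_eq, stretchedNorm_update, ← hB, radial, Function.update_self]
      field_simp
      ring
    rw [e, eval_smul, smul_eq_mul, ← mul_sub, abs_mul, abs_of_pos (inv_pos.2 hs0)]
    have h2 := hpe t ht
    calc _ ≤ 1 * (C₁ * W ^ m / D ^ (2 + m)) := by
          gcongr
          exact inv_le_one_of_one_le₀ hs
      _ ≤ _ := by
          rw [one_mul]
          gcongr
          linarith
  · have hx : |x c - y c| ≤ √B := by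
      refine Real.abs_le_sqrt ?_
      refine le_trans ?_ (Finset.single_le_sum (fun _ _ => sq_nonneg _)
        (Finset.mem_erase.2 ⟨hck, Finset.mem_univ c⟩))
      rw [mul_pow]
      exact le_mul_of_one_le_left (sq_nonneg _) (one_le_pow₀ (one_le_stretch hγ c))
    -- The numerator `x c - y c` is constant in `t` and may be large. It also bounds `r` from below,
    -- so including it in `ρ` lets one power of `ρ` absorb it.
    set ρ := max D |x c - y c| with hρ
    have hρ0 : 0 < ρ := hD.trans_le (le_max_left _ _)
    obtain ⟨p, hp, hpe⟩ := H₂ _ (-(stretch γ k * y k)) B a b W ρ hB0 hρ0 hab hW (fun t ht =>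
      max_le (hr' t ht) (hx.trans (Real.sqrt_le_sqrt (le_add_of_nonneg_left (sq_nonneg _)))))
    refine ⟨(x c - y c) • p, (degree_smul_le _ _).trans_lt hp, fun t ht => ?_⟩
    have e : kernel γ (Function.update x k t) y c
        = (x c - y c) * radial (stretch γ k) (-(stretch γ k * y k)) B 0 3 t := by
      rw [kernel_eq, stretchedNorm_update, ← hB, radial, Function.update_of_ne hck]
      simp [div_eq_mul_inv]
    rw [e, eval_smul, smul_eq_mul, ← mul_sub, abs_mul]
    have h2 := hpe t ht
    calc _ ≤ ρ * (C₂ * W ^ m / ρ ^ (3 + m)) := by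
          gcongr
          exact le_max_right _ _
      _ = C₂ * W ^ m / ρ ^ (2 + m) := by
          rw [show 3 + m = (2 + m) + 1 by ring, pow_succ]
          field_simp
      _ ≤ _ := by
          gcongr
          · linarith
          · exact le_max_left _ _

lemma exists_kernel_interpolation_bound (n : ℕ) : ∃ C : ℝ, 0 ≤ C ∧
    ∀ γ : ℝ, 1 ≤ γ → ∀ (S : Set (Fin 3 → ℝ)), IsCompact S → S.Nonempty →
    ∀ (Λ δ D : ℝ) (ξ : Fin 3 → Fin (n + 1) → ℝ) (y : Fin 3 → ℝ) (c : Fin 3), 1 ≤ Λ →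
      IsInterpolationGrid Λ (boundingBox S) ξ → stretchedDiam (stretch γ) S ≤ δ → 0 < D →
      (∀ x ∈ boundingBox S, D ≤ stretchedNorm (stretch γ) x y) →
      ∀ x ∈ boundingBox S,
        |kernel γ x y c - ∑ μ, tensorLagrange ξ μ x * kernel γ (gridPoint ξ μ) y c|
          ≤ 3 * Λ ^ 3 * ((1 + Λ) * (C * δ ^ (n + 1) / D ^ (2 + (n + 1)))) := by
  obtain ⟨C, hC, H⟩ := exists_polynomial_approx_kernel (n + 1)
  refine ⟨C, hC, fun γ hγ S hS hne Λ δ D ξ y c hΛ hξ hδ hD hr x hx => ?_⟩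
  have hδ0 : 0 ≤ δ := (stretchedDiam_nonneg _ S).trans hδ
  set lo : Fin 3 → ℝ := fun k => sInf ((fun x : Fin 3 → ℝ => x k) '' S) with hlo
  set hi : Fin 3 → ℝ := fun k => sSup ((fun x : Fin 3 → ℝ => x k) '' S) with hhi
  have hbox : ∀ z, z ∈ boundingBox S ↔ ∀ k, z k ∈ Set.Icc (lo k) (hi k) := fun z =>
    ⟨fun h k => ⟨h.1 k, h.2 k⟩, fun h => ⟨fun k => (h k).1, fun k => (h k).2⟩⟩
  have hupd : ∀ z ∈ boundingBox S, ∀ k, ∀ t ∈ Set.Icc (lo k) (hi k),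
      Function.update z k t ∈ boundingBox S := by
    intro z hz k t ht
    rw [hbox] at hz ⊢
    intro j
    rcases eq_or_ne j k with rfl | hj
    · rwa [Function.update_self]
    · rw [Function.update_of_ne hj]
      exact hz j
  have hnode : ∀ k i, ξ k i ∈ Set.Icc (lo k) (hi k) := fun k i =>
    (hbox _).1 (hξ.mem fun _ => i) k
  have key := abs_sub_tensor_le (κ := Fin (n + 1)) (Λ := Λ)
    (E := (1 + Λ) * (C * δ ^ (n + 1) / D ^ (2 + (n + 1)))) hΛ (by positivity) 3
    (fun k => Set.Icc (lo k) (hi k)) ξ (fun k i t => lagrange (ξ k) i t) hnode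
    (fun k t ht => by
      simpa using hξ.lebesgue_le k _ (hupd x hx k t ht))
    (fun z => kernel γ z y c)
    (fun k z hz => by
      have hz' := (hbox z).2 hz
      obtain ⟨p, hp, hpe⟩ := H γ hγ (lo k) (hi k) δ D k c z y hD ((hz k).1.trans (hz k).2)
        (side_le hS hne hδ k) (fun t ht => hr _ (hupd z hz' k t ht))
      have := abs_sub_lagrange_le (hξ.injective k) hp hpe (hnode k) (hz k)
        (hξ.lebesgue_le k z hz')
      simpa only [Function.update_eq_self] using this)
    x ((hbox x).1 hx)
  exact_mod_cast key

/-- The interpolation error in terms of a lower bound `D` for the stretched distance of points of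
the two boxes. -/
lemma exists_interpolation_error_bound (n : ℕ) (Λ : ℝ) : ∃ C : ℝ, 0 < C ∧
    ∀ γ : ℝ, 1 ≤ γ → ∀ St Ss : Set (Fin 3 → ℝ),
      IsCompact St → St.Nonempty → IsCompact Ss → Ss.Nonempty →
    ∀ ξt ξs : Fin 3 → Fin (n + 1) → ℝ, IsInterpolationGrid Λ (boundingBox St) ξt →
      IsInterpolationGrid Λ (boundingBox Ss) ξs →
    ∀ δ D : ℝ, stretchedDiam (stretch γ) St ≤ δ → stretchedDiam (stretch γ) Ss ≤ δ → 0 < D →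
      (∀ x ∈ boundingBox St, ∀ y ∈ boundingBox Ss, D ≤ stretchedNorm (stretch γ) x y) →
      ∀ x ∈ boundingBox St, ∀ y ∈ boundingBox Ss,
        ‖kernel γ x y - interpolant ξt ξs (kernel γ) x y‖
          ≤ C / D ^ 2 * (δ / D) ^ (n + 1) := by
  obtain ⟨C, hC, H⟩ := exists_kernel_interpolation_bound n
  -- The constant is chosen before any grid is given, hence `|Λ|`; the summand `1` makes it
  -- positive.
  refine ⟨(1 + |Λ| ^ 3) * (3 * |Λ| ^ 3 * ((1 + |Λ|) * C)) + 1, by positivity,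
    fun γ hγ St Ss hSt hSt' hSs hSs' ξt ξs hξt hξs δ D hδt hδs hD hr x hx y hy => ?_⟩
  -- The Lagrange basis sums to 1, which forces `Λ ≥ 1`.
  have hΛ : 1 ≤ Λ := (one_le_sum_abs_lagrange (hξt.injective 0) _).trans (hξt.lebesgue_le 0 x hx)
  have hδ0 : 0 ≤ δ := (stretchedDiam_nonneg _ St).trans hδt
  rw [abs_of_nonneg (zero_le_one.trans hΛ)]
  set E := 3 * Λ ^ 3 * ((1 + Λ) * (C * δ ^ (n + 1) / D ^ (2 + (n + 1)))) with hE
  have hE0 : 0 ≤ E := by positivity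
  have hfin : (1 + Λ ^ 3) * E
      ≤ ((1 + Λ ^ 3) * (3 * Λ ^ 3 * ((1 + Λ) * C)) + 1) / D ^ 2 * (δ / D) ^ (n + 1) := by
    have e : (1 + Λ ^ 3) * E
        = ((1 + Λ ^ 3) * (3 * Λ ^ 3 * ((1 + Λ) * C))) / D ^ 2 * (δ / D) ^ (n + 1) := by
      rw [hE, div_pow, pow_add D 2]
      field_simp
    rw [e]
    gcongr
    linarith
  refine le_trans ?_ hfin
  rw [pi_norm_le_iff_of_nonneg (by positivity)]
  intro c
  have h1 := H γ hγ St hSt hSt' Λ δ D ξt y c hΛ hξt hδt hD (fun z hz => hr z hz y hy) x hx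
  have h2 : ∀ z ∈ boundingBox St,
      |kernel γ z y c - ∑ ν, tensorLagrange ξs ν y * kernel γ z (gridPoint ξs ν) c| ≤ E := by
    intro z hz
    have := H γ hγ Ss hSs hSs' Λ δ D ξs z c hΛ hξs hδs hD
      (fun w hw => by rw [stretchedNorm_comm]; exact hr z hz w hw) y hy
    rw [kernel_swap, ← abs_neg] at this
    refine le_of_eq_of_le (congrArg _ ?_) this
    simp only [kernel_swap γ z (gridPoint ξs _), mul_neg, Finset.sum_neg_distrib]
    ring
  -- Interpolate in `x` first; the `y`-errors at the grid points then grow by at most `Λ ^ 3`.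
  have e : (kernel γ x y - interpolant ξt ξs (kernel γ) x y) c
      = (kernel γ x y c - ∑ μ, tensorLagrange ξt μ x * kernel γ (gridPoint ξt μ) y c)
        + ∑ μ, tensorLagrange ξt μ x * (kernel γ (gridPoint ξt μ) y c
          - ∑ ν, tensorLagrange ξs ν y * kernel γ (gridPoint ξt μ) (gridPoint ξs ν) c) := by
    simp only [interpolant, Pi.sub_apply, Finset.sum_apply, Pi.smul_apply, smul_eq_mul, mul_sub,
      Finset.sum_sub_distrib, Finset.mul_sum, mul_assoc]
    ring
  rw [e, Real.norm_eq_abs]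
  refine (abs_add_le _ _).trans ?_
  have h3 : |∑ μ, tensorLagrange ξt μ x * (kernel γ (gridPoint ξt μ) y c
      - ∑ ν, tensorLagrange ξs ν y * kernel γ (gridPoint ξt μ) (gridPoint ξs ν) c)|
      ≤ Λ ^ 3 * E := by
    refine (Finset.abs_sum_le_sum_abs _ _).trans ?_
    calc _ ≤ ∑ μ, |tensorLagrange ξt μ x| * E := by
          gcongr with μ
          rw [abs_mul]
          gcongr
          exact h2 _ (hξt.mem μ)
      _ = (∑ μ, |tensorLagrange ξt μ x|) * E := by rw [Finset.sum_mul]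
      _ ≤ _ := by
          gcongr
          exact sum_abs_tensorLagrange_le ξt x fun k => hξt.lebesgue_le k x hx
  linarith

end RelativisticFMM

/-! ### The two error bounds -/

theorem mainTheorem3 (n : ℕ) (Λ : ℝ) :
    -- distance between the bounding boxes, no restriction on the ratio
    (∃ C : ℝ, 0 < C ∧
      ∀ (γ : ℝ), 1 ≤ γ → ∀ (St Ss : Set (Fin 3 → ℝ)),
        IsCompact St → St.Nonempty → IsCompact Ss → Ss.Nonempty →
      ∀ (ξt ξs : Fin 3 → Fin (n + 1) → ℝ),
        RelativisticFMM.IsInterpolationGrid Λ (RelativisticFMM.boundingBox St) ξt →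
        RelativisticFMM.IsInterpolationGrid Λ (RelativisticFMM.boundingBox Ss) ξs →
      ∀ (δ d : ℝ),
        δ = max (RelativisticFMM.stretchedDiam (RelativisticFMM.stretch γ) St)
          (RelativisticFMM.stretchedDiam (RelativisticFMM.stretch γ) Ss) →
        d = RelativisticFMM.stretchedDist (RelativisticFMM.stretch γ)
          (RelativisticFMM.boundingBox St) (RelativisticFMM.boundingBox Ss) →
        0 < d →
      ∀ x ∈ RelativisticFMM.boundingBox St, ∀ y ∈ RelativisticFMM.boundingBox Ss,
        ‖RelativisticFMM.kernel γ x y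
            - RelativisticFMM.interpolant ξt ξs (RelativisticFMM.kernel γ) x y‖
          ≤ C / d ^ 2 * (δ / d) ^ (n + 1) ∧
        ∀ η : ℝ, 0 < η → δ / d < η →
          ‖RelativisticFMM.kernel γ x y
              - RelativisticFMM.interpolant ξt ξs (RelativisticFMM.kernel γ) x y‖
            ≤ C / d ^ 2 * η ^ (n + 1)) ∧
    -- distance between the clusters themselves, under the admissibility condition
    (∀ η : ℝ, 0 < η → √6 * η < 1 → ∃ C : ℝ, 0 < C ∧
      ∀ (γ : ℝ), 1 ≤ γ → ∀ (St Ss : Set (Fin 3 → ℝ)),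
        IsCompact St → St.Nonempty → IsCompact Ss → Ss.Nonempty →
      ∀ (ξt ξs : Fin 3 → Fin (n + 1) → ℝ),
        RelativisticFMM.IsInterpolationGrid Λ (RelativisticFMM.boundingBox St) ξt →
        RelativisticFMM.IsInterpolationGrid Λ (RelativisticFMM.boundingBox Ss) ξs →
      ∀ (δ d : ℝ),
        δ = max (RelativisticFMM.stretchedDiam (RelativisticFMM.stretch γ) St)
          (RelativisticFMM.stretchedDiam (RelativisticFMM.stretch γ) Ss) →
        d = RelativisticFMM.stretchedDist (RelativisticFMM.stretch γ) St Ss →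
        0 < d → δ / d < η →
      ∀ x ∈ RelativisticFMM.boundingBox St, ∀ y ∈ RelativisticFMM.boundingBox Ss,
        ‖RelativisticFMM.kernel γ x y
            - RelativisticFMM.interpolant ξt ξs (RelativisticFMM.kernel γ) x y‖
          ≤ C / d ^ 2 * (δ / d) ^ (n + 1) ∧
        ‖RelativisticFMM.kernel γ x y
            - RelativisticFMM.interpolant ξt ξs (RelativisticFMM.kernel γ) x y‖
          ≤ C / d ^ 2 * η ^ (n + 1)) := by
  obtain ⟨C, hC, H⟩ := RelativisticFMM.exists_interpolation_error_bound n Λ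
  constructor
  · refine ⟨C, hC, fun γ hγ St Ss hSt hSt' hSs hSs' ξt ξs hξt hξs δ d hδ hd hd0 x hx y hy => ?_⟩
    have hδt := (le_max_left _ _).trans_eq hδ.symm
    have hδs := (le_max_right _ _).trans_eq hδ.symm
    have hδ0 : 0 ≤ δ := (RelativisticFMM.stretchedDiam_nonneg _ _).trans hδt
    have key := H γ hγ St Ss hSt hSt' hSs hSs' ξt ξs hξt hξs δ d hδt hδs hd0
      (fun u hu v hv => hd.trans_le (RelativisticFMM.stretchedDist_le_stretchedNorm _ hu hv))
      x hx y hy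
    refine ⟨key, fun η _ hη => key.trans ?_⟩
    gcongr
  · intro η hη0 hη6
    have hκ : 0 < 1 - √6 * η := by linarith
    -- With `D = (1 - √6 * η) * d`, two powers come from `D ^ 2` and `n + 1` from `(δ / D) ^ (n +
    -- 1)`.
    refine ⟨C / (1 - √6 * η) ^ (n + 3), by positivity,
      fun γ hγ St Ss hSt hSt' hSs hSs' ξt ξs hξt hξs δ d hδ hd hd0 hη x hx y hy => ?_⟩
    have hδt := (le_max_left _ _).trans_eq hδ.symm
    have hδs := (le_max_right _ _).trans_eq hδ.symm
    have hδ0 : 0 ≤ δ := (RelativisticFMM.stretchedDiam_nonneg _ _).trans hδt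
    have hδη : δ ≤ η * d := ((div_lt_iff₀ hd0).1 hη).le
    have key := H γ hγ St Ss hSt hSt' hSs hSs' ξt ξs hξt hξs δ ((1 - √6 * η) * d) hδt hδs
      (by positivity)
      (fun u hu v hv => by
        rw [hd] at hδη ⊢
        exact RelativisticFMM.le_stretchedNorm_of_admissible hSt hSt' hSs hSs' hδt hδs hδη hu hv)
      x hx y hy
    have e : C / ((1 - √6 * η) * d) ^ 2 * (δ / ((1 - √6 * η) * d)) ^ (n + 1)
        = C / (1 - √6 * η) ^ (n + 3) / d ^ 2 * (δ / d) ^ (n + 1) := by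
      rw [div_pow, div_pow, mul_pow, mul_pow, show n + 3 = 2 + (n + 1) by ring,
        pow_add (1 - √6 * η) 2]
      field_simp
    rw [e] at key
    refine ⟨key, key.trans ?_⟩
    gcongr
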